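/- Work in the category of abelian groups ($\mathbb Z$-modules), and for a class $\mathcal C$ of abelian groups put $\mathcal C^{\perp}=\{Y \mid \operatorname{Ext}^1_{\mathbb Z}(D,Y)=0 \text{ for all } D\in\mathcal C\}$ and ${}^{\perp}\mathcal C=\{Z \mid \operatorname{Ext}^1_{\mathbb Z}(Z,D)=0 \text{ for all } D\in\mathcal C\}$. An abelian group $M$ is Mittag-Leffler if for every family $(M_i)_{i\in I}$ of abelian groups the canonical map $M\otimes\prod_{i\in I} M_i\to\prod_{i\in I}(M\otimes M_i)$ is injective; it is $\aleph_1$-free if each of its countably generated subgroups is free; it is cotorsion if $\operatorname{Ext}^1_{\mathbb Z}(\mathbb Q,M)=0$. Let $\mathcal D$ be the class of all flat Mittag-Leffler abelian groups. Then: (i) $\mathcal D$ is the class of all $\aleph_1$-free abelian groups; (ii) $\mathcal D\neq{}^{\perp}\mathcal C$ for every class $\mathcal C$ of abelian groups; (iii) $\mathcal D^{\perp}$ is the class of all cotorsion abelian groups; (iv) ${}^{\perp}(\mathcal D^{\perp})$ is the class of all flat abelian groups, and these are exactly the torsion-free abelian groups. -/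

import Mathlib

open CategoryTheory
open scoped TensorProduct

universe v u

/-- A module `M` over a commutative ring is Mittag-Leffler if, for every family `(Nᵢ)` of modules,
the canonical map `M ⊗ ∏ᵢ Nᵢ → ∏ᵢ (M ⊗ Nᵢ)` is injective. -/
def IsMittagLeffler (R : Type v) [CommRing R] (M : Type u) [AddCommGroup M] [Module R M] :
    Prop :=
  ∀ (I : Type u) (N : I → Type u) [∀ i, AddCommGroup (N i)] [∀ i, Module R (N i)],
    Function.Injective (TensorProduct.piRightHom R R M N)

/-- A module is `ℵ₁`-free if each of its countably generated submodules is free. -/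
def IsAlephOneFree (R : Type v) [CommRing R] (M : Type u) [AddCommGroup M] [Module R M] : Prop :=
  ∀ s : Set M, s.Countable → Module.Free R (Submodule.span R s)

/-- The class of flat Mittag-Leffler abelian groups. -/
def flatMittagLefflerGroups : ObjectProperty (ModuleCat.{u} ℤ) :=
  fun M => Module.Flat ℤ M ∧ IsMittagLeffler ℤ M

/-- The class of `ℵ₁`-free abelian groups. -/
def alephOneFreeGroups : ObjectProperty (ModuleCat.{u} ℤ) :=
  fun M => IsAlephOneFree ℤ M

/-- The class of flat abelian groups. -/
def flatGroups : ObjectProperty (ModuleCat.{u} ℤ) :=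
  fun M => Module.Flat ℤ M

/-- The class of torsion-free abelian groups. -/
def torsionFreeGroups : ObjectProperty (ModuleCat.{u} ℤ) :=
  fun M => Module.IsTorsionFree ℤ M

/-- The class of cotorsion abelian groups: those `A` with `Ext¹(ℚ, A) = 0`. -/
def cotorsionGroups : ObjectProperty (ModuleCat.{u} ℤ) :=
  fun A => Subsingleton (Abelian.Ext (ModuleCat.of ℤ (ULift.{u} ℚ)) A 1)

/-- The right orthogonal class `C^⊥ = {Y | Ext¹(D, Y) = 0 for all D ∈ C}`. -/
def extRightPerp (C : ObjectProperty (ModuleCat.{u} ℤ)) : ObjectProperty (ModuleCat.{u} ℤ) :=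
  fun Y => ∀ D : ModuleCat.{u} ℤ, C D → Subsingleton (Abelian.Ext D Y 1)

/-- The left orthogonal class `^⊥C = {Z | Ext¹(Z, D) = 0 for all D ∈ C}`. -/
def extLeftPerp (C : ObjectProperty (ModuleCat.{u} ℤ)) : ObjectProperty (ModuleCat.{u} ℤ) :=
  fun Z => ∀ D : ModuleCat.{u} ℤ, C D → Subsingleton (Abelian.Ext Z D 1)

/-! Fix 0 → A → I → J → 0 with I and J divisible; then Ext¹(X, A) = 0 means that every map X → J
lifts to I. For torsion-free groups, Mittag-Leffler and ℵ₁-free are both equivalent to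
`HasFGPureClosures`; this gives (i), and shows that every power ℤ^T lies in 𝒟.

Cotorsion groups are orthogonal to all flat groups, since a flat group embeds in a rational vector
space. The converse needed for (iii) is `exists_lift_rat_of_exists_lift_pi`: a tree T with A-valued
labels is chosen so that ℤ^T modulo the finitely supported functions contains one copy of ℚ for each
labelling T → A. A lift on ℤ^T determines a labelling, and the copy of ℚ for that labelling yields a
lift of the given map ℚ → J.

Bounded groups are cotorsion and detect torsion, whence (iv). If 𝒟 = ^⊥C, then C ⊆ 𝒟^⊥ consists of
cotorsion groups, so ℚ ∈ ^⊥C = 𝒟; but ℚ is not ℵ₁-free. -/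

/-! ### Divisible groups and Ext¹ -/

theorem exists_extension_of_divisible {X Y J : Type*} [AddCommGroup X] [AddCommGroup Y]
    [AddCommGroup J] (hJ : ∀ n : ℤ, n ≠ 0 → Function.Surjective fun x : J => n • x)
    (i : X →ₗ[ℤ] Y) (hi : Function.Injective i) (f : X →ₗ[ℤ] J) :
    ∃ g : Y →ₗ[ℤ] J, ∀ x, g (i x) = f x := by
  let : DivisibleBy J ℤ := divisibleByOfSMulRightSurj _ _ fun {n} hn => hJ n hn
  obtain ⟨g, hg⟩ := (Module.Baer.of_divisible J).extension_property_addMonoidHom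
    i.toAddMonoidHom hi f.toAddMonoidHom
  exact ⟨g.toIntLinearMap, fun x => DFunLike.congr_fun hg x⟩

theorem smul_surjective_of_injective {I : ModuleCat.{u} ℤ} [Injective I] (n : ℤ) (hn : n ≠ 0) :
    Function.Surjective fun x : I => n • x := by
  intro x
  let m : ModuleCat.of ℤ (ULift.{u} ℤ) ⟶ ModuleCat.of ℤ (ULift.{u} ℤ) :=
    ModuleCat.ofHom (n • LinearMap.id)
  have : Mono m := by
    rw [ModuleCat.mono_iff_injective]
    intro a b hab
    have : n * a.down = n * b.down := congrArg ULift.down hab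
    exact ULift.ext _ _ (mul_left_cancel₀ hn this)
  let f : ModuleCat.of ℤ (ULift.{u} ℤ) ⟶ I :=
    ModuleCat.ofHom (LinearMap.toSpanSingleton ℤ I x ∘ₗ ULift.moduleEquiv.toLinearMap)
  let g := Injective.factorThru f m
  have hg : m ≫ g = f := Injective.comp_factorThru f m
  refine ⟨g.hom (ULift.up 1), ?_⟩
  have h1 : g.hom (m.hom (ULift.up 1)) = f.hom (ULift.up 1) :=
    congrArg (fun k => k.hom (ULift.up 1)) hg
  have h2 : m.hom (ULift.up 1) = n • ULift.up 1 := rfl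
  have h3 : f.hom (ULift.up 1) = x := (int_smul_eq_zsmul _ _ _).trans (one_zsmul x)
  rw [h2, map_zsmul, h3] at h1
  exact h1

/-- `Ext¹(-, A)` is computed by a two-term resolution of `A` by divisible groups. -/
theorem exists_divisible_resolution (A : ModuleCat.{u} ℤ) :
    ∃ (I J : ModuleCat.{u} ℤ) (ι : A →ₗ[ℤ] I) (π : I →ₗ[ℤ] J),
      Function.Injective ι ∧ Function.Surjective π ∧ Function.Exact ι π ∧
      (∀ n : ℤ, n ≠ 0 → Function.Surjective fun x : I => n • x) ∧
      (∀ n : ℤ, n ≠ 0 → Function.Surjective fun x : J => n • x) ∧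
      ∀ X : ModuleCat.{u} ℤ, Subsingleton (Abelian.Ext X A 1) ↔
        ∀ f : X →ₗ[ℤ] J, ∃ g : X →ₗ[ℤ] I, π ∘ₗ g = f := by
  let S : ShortComplex (ModuleCat.{u} ℤ) :=
    ShortComplex.mk (Injective.ι A) (Limits.cokernel.π (Injective.ι A))
      (Limits.cokernel.condition _)
  have hS : S.ShortExact :=
    { exact := ShortComplex.exact_of_g_is_cokernel _ (Limits.cokernelIsCokernel (Injective.ι A)) }
  have hI : ∀ n : ℤ, n ≠ 0 → Function.Surjective fun x : S.X₂ => n • x :=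
    fun n hn => smul_surjective_of_injective (I := Injective.under A) n hn
  have hπ : Function.Surjective S.g.hom := hS.moduleCat_surjective_g
  refine ⟨S.X₂, S.X₃, S.f.hom, S.g.hom, hS.moduleCat_injective_f, hπ, ?_, hI, ?_, ?_⟩
  · exact (ShortComplex.ShortExact.moduleCat_exact_iff_function_exact S).1 hS.exact
  · intro n hn x
    obtain ⟨x, rfl⟩ := hπ x
    obtain ⟨y, rfl⟩ := hI n hn x
    exact ⟨S.g.hom y, (map_zsmul _ _ _).symm⟩
  · intro X
    constructor
    · intro h f
      obtain ⟨x₂, hx⟩ := Abelian.Ext.covariant_sequence_exact₃ X hS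
        (Abelian.Ext.mk₀ (ModuleCat.ofHom f)) (zero_add 1)
        (@Subsingleton.elim _ (show Subsingleton (Abelian.Ext X S.X₁ 1) from h) _ _)
      obtain ⟨g, rfl⟩ := Abelian.Ext.mk₀_bijective X S.X₂ |>.2 x₂
      rw [Abelian.Ext.mk₀_comp_mk₀] at hx
      have := (Abelian.Ext.mk₀_bijective X S.X₃).1 hx
      exact ⟨g.hom, congrArg ModuleCat.Hom.hom this⟩
    · intro h
      refine subsingleton_of_forall_eq 0 fun x => ?_
      have : Injective S.X₂ := inferInstanceAs (Injective (Injective.under A))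
      obtain ⟨x₃, rfl⟩ := Abelian.Ext.covariant_sequence_exact₁ X hS x
        (Abelian.Ext.eq_zero_of_injective _) (zero_add 1)
      obtain ⟨f, rfl⟩ := Abelian.Ext.mk₀_bijective X S.X₃ |>.2 x₃
      obtain ⟨g, hg⟩ := h f.hom
      have : f = ModuleCat.ofHom g ≫ S.g := ModuleCat.hom_ext hg.symm
      rw [this, ← Abelian.Ext.mk₀_comp_mk₀, Abelian.Ext.comp_assoc_of_second_deg_zero,
        hS.comp_extClass, Abelian.Ext.comp_zero]

/-- Uniqueness of ℤ-module structures lets every object be taken with its canonical one. -/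
theorem ModuleCat.exists_eq_of_int (M : ModuleCat.{u} ℤ) :
    ∃ (X : Type u) (_ : AddCommGroup X), M = ModuleCat.of ℤ X := by
  obtain @⟨X, _, m⟩ := M
  obtain rfl := Subsingleton.elim m (AddCommGroup.toIntModule X)
  exact ⟨X, _, rfl⟩

theorem exists_divisible_resolution_int (A : Type u) [AddCommGroup A] :
    ∃ (I J : Type u) (_ : AddCommGroup I) (_ : AddCommGroup J) (ι : A →ₗ[ℤ] I) (π : I →ₗ[ℤ] J),
      Function.Injective ι ∧ Function.Surjective π ∧ Function.Exact ι π ∧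
      (∀ n : ℤ, n ≠ 0 → Function.Surjective fun x : I => n • x) ∧
      (∀ n : ℤ, n ≠ 0 → Function.Surjective fun x : J => n • x) ∧
      ∀ (X : Type u) [AddCommGroup X],
        Subsingleton (Abelian.Ext (ModuleCat.of ℤ X) (ModuleCat.of ℤ A) 1) ↔
          ∀ f : X →ₗ[ℤ] J, ∃ g : X →ₗ[ℤ] I, π ∘ₗ g = f := by
  obtain ⟨I, J, ι, π, hι, hπ, hex, hI, hJ, hext⟩ := exists_divisible_resolution (ModuleCat.of ℤ A)
  obtain ⟨I, _, rfl⟩ := I.exists_eq_of_int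
  obtain ⟨J, _, rfl⟩ := J.exists_eq_of_int
  exact ⟨I, J, _, _, ι, π, hι, hπ, hex, hI, hJ, fun X _ => hext (ModuleCat.of ℤ X)⟩

/-! ### Homomorphisms out of ℚ -/

section RatHom

variable {M : Type*} [AddCommGroup M]

open Nat in
theorem Rat.exists_eq_intCast_div_factorial (q : ℚ) : ∃ (k : ℤ) (n : ℕ), q = k / n ! := by
  refine ⟨q.num * (q.den - 1)!, q.den, ?_⟩
  have h : (q.den ! : ℚ) = q.den * (q.den - 1)! := by
    exact_mod_cast (Nat.mul_factorial_pred q.den_nz).symm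
  have h₁ : ((q.den - 1)! : ℚ) ≠ 0 := by exact_mod_cast Nat.factorial_ne_zero _
  rw [h]
  push_cast
  rw [mul_div_mul_right _ _ h₁, Rat.num_div_den]

open Nat in
theorem Rat.linearMap_ext_factorial {f g : ℚ →ₗ[ℤ] M} (h : ∀ n : ℕ, f (1 / n !) = g (1 / n !)) :
    f = g := by
  ext q
  obtain ⟨k, n, rfl⟩ := Rat.exists_eq_intCast_div_factorial q
  have : (k : ℚ) / n ! = k • (1 / n ! : ℚ) := by rw [zsmul_eq_mul, mul_one_div]
  rw [this, map_zsmul, map_zsmul, h]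

open Nat in
/-- `ℚ` is the colimit of the multiplications by `1, 2, 3, …` on `ℤ`. -/
theorem Rat.exists_linearMap_factorial (v : ℕ → M) (hv : ∀ n : ℕ, v n = ((n : ℤ) + 1) • v (n + 1)) :
    ∃ f : ℚ →ₗ[ℤ] M, ∀ n : ℕ, f (1 / n !) = v n := by
  -- The constant is c = (n + d)! / n!.
  have hle : ∀ n d : ℕ, ∃ c : ℤ, c * n ! = (n + d)! ∧ v n = c • v (n + d) := by
    intro n d
    induction d with
    | zero => exact ⟨1, by simp, by simp⟩
    | succ d ih =>
      obtain ⟨c, hc, hvc⟩ := ih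
      refine ⟨c * ((n + d : ℕ) + 1), ?_, ?_⟩
      · rw [← add_assoc, Nat.factorial_succ]
        push_cast at hc ⊢
        linear_combination (n + d + 1 : ℤ) * hc
      · rw [hvc, hv (n + d), smul_smul, add_assoc]
  have hne : ∀ n : ℕ, (n ! : ℚ) ≠ 0 := fun n => by exact_mod_cast n.factorial_ne_zero
  have hneZ : ∀ n : ℕ, (n ! : ℤ) ≠ 0 := fun n => by exact_mod_cast n.factorial_ne_zero
  have hwd : ∀ (k l : ℤ) (n m : ℕ), (k : ℚ) / n ! = l / m ! → k • v n = l • v m := by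
    have aux : ∀ (k l : ℤ) (n d : ℕ), (k : ℚ) / n ! = l / (n + d)! → k • v n = l • v (n + d) := by
      intro k l n d h
      obtain ⟨c, hc, hvc⟩ := hle n d
      rw [div_eq_div_iff (hne _) (hne _)] at h
      have h' : k * (n + d)! = l * n ! := by exact_mod_cast h
      rw [hvc, smul_smul]
      congr 1
      refine mul_right_cancel₀ (hneZ n) ?_
      rw [← h', ← hc, mul_assoc]
    intro k l n m h
    rcases le_total n m with hnm | hnm
    · obtain ⟨d, rfl⟩ := Nat.exists_eq_add_of_le hnm
      exact aux k l n d h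
    · obtain ⟨d, rfl⟩ := Nat.exists_eq_add_of_le hnm
      exact (aux l k m d h.symm).symm
  choose k n hkn using Rat.exists_eq_intCast_div_factorial
  have hf : ∀ (q : ℚ) (l : ℤ) (m : ℕ), q = l / m ! → k q • v (n q) = l • v m := fun q l m h =>
    hwd _ _ _ _ ((hkn q).symm.trans h)
  let f : ℚ →+ M := AddMonoidHom.mk' (fun q => k q • v (n q)) fun p q => by
    obtain ⟨c, hc, hvc⟩ := hle (n p) (n q)
    obtain ⟨c', hc', hvc'⟩ := hle (n q) (n p)
    rw [add_comm] at hc' hvc'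
    rw [hf (p + q) (k p * c + k q * c') (n p + n q) ?_, add_smul, mul_smul, mul_smul, ← hvc, ← hvc']
    have e : (c : ℚ) * (n p)! = (n p + n q)! := by exact_mod_cast hc
    have e' : (c' : ℚ) * (n q)! = (n p + n q)! := by exact_mod_cast hc'
    have h₁ : p * (n p)! = k p := (eq_div_iff (hne _)).1 (hkn p)
    have h₂ : q * (n q)! = k q := (eq_div_iff (hne _)).1 (hkn q)
    rw [eq_div_iff (hne _)]
    push_cast
    rw [← h₁, ← h₂, add_mul]
    nth_rewrite 1 [← e]
    rw [← e']
    ring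
  exact ⟨f.toIntLinearMap, fun m => (hf _ 1 m (by simp)).trans (one_smul _ _)⟩

end RatHom

/-! ### The tree of labellings and its branches -/

section Tree

/-- The levels of a tree: a node of level `n + 1` is a node of level `n` together with an
`A`-valued function on level `n`. -/
def TreeLevel (A : Type u) : ℕ → Type u
  | 0 => PUnit
  | n + 1 => TreeLevel A n × (TreeLevel A n → A)

/-- The nodes of the tree. -/
abbrev TreeNode (A : Type u) : Type u := Σ n, TreeLevel A n

variable {A : Type u}

/-- The nodes on the branch given by an `A`-valued function on the tree. -/
def branchNode (g : TreeNode A → A) : ∀ n, TreeLevel A n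
  | 0 => PUnit.unit
  | n + 1 => (branchNode g n, fun t => g ⟨n, t⟩)

theorem branchNode_eq_of_le {g g' : TreeNode A → A} {m n : ℕ} (hmn : m ≤ n)
    (h : branchNode g n = branchNode g' n) : branchNode g m = branchNode g' m := by
  induction n, hmn using Nat.le_induction with
  | base => exact h
  | succ n _ ih => exact ih (congrArg Prod.fst h)

/-- A node of level n + 1 on the branch of g records all values of g on level n. -/
theorem branchNode_injective : Function.Injective (branchNode (A := A)) := by
  intro g g' h
  funext ⟨n, t⟩
  exact congrFun (congrArg Prod.snd (congrFun h (n + 1))) t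

theorem exists_forall_branchNode_ne (g g' : TreeNode A → A) :
    ∃ m, ∀ n, m ≤ n → g ≠ g' → branchNode g n ≠ branchNode g' n := by
  by_cases h : g = g'
  · exact ⟨0, fun _ _ hne => (hne h).elim⟩
  obtain ⟨m, hm⟩ := Function.ne_iff.1 (branchNode_injective.ne h)
  exact ⟨m, fun n hmn _ hn => hm (branchNode_eq_of_le hmn hn)⟩

open scoped Classical Nat in
/-- The integer valued function with value `i! / n!` at the nodes of level `i ≥ n` of a branch, and
`0` elsewhere. -/
noncomputable def branchFun (g : TreeNode A → A) (n : ℕ) : TreeNode A → ℤ := fun t =>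
  if n ≤ t.1 ∧ t.2 = branchNode g t.1 then ((t.1 ! / n ! : ℕ) : ℤ) else 0

-- Modulo finitely supported functions the last term disappears, so these functions satisfy the same
-- relations as the 1 / n! and define a map from ℚ.
open scoped Classical Nat in
theorem branchFun_eq (g : TreeNode A → A) (n : ℕ) :
    branchFun g n = ((n : ℤ) + 1) • branchFun g (n + 1) + Pi.single ⟨n, branchNode g n⟩ 1 := by
  funext ⟨i, t⟩
  simp only [branchFun, Pi.add_apply, Pi.smul_apply, smul_eq_mul]
  rcases lt_trichotomy n i with h | rfl | h
  · rw [Pi.single_eq_of_ne (by rintro ⟨⟩; exact h.ne rfl)]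
    simp only [h.le, Nat.succ_le_of_lt h, true_and, add_zero]
    split_ifs
    · have hdvd := Nat.factorial_dvd_factorial (Nat.succ_le_of_lt h)
      have : i ! / n ! = (n + 1) * (i ! / (n + 1)!) := by
        obtain ⟨c, hc⟩ := hdvd
        rw [hc, Nat.mul_div_cancel_left _ (Nat.factorial_pos _), Nat.factorial_succ, mul_assoc,
          mul_left_comm, Nat.mul_div_cancel_left _ (Nat.factorial_pos _)]
      exact_mod_cast this
    · simp
  · by_cases ht : t = branchNode g n
    · subst ht
      simp [Nat.div_self (Nat.factorial_pos _)]
    · rw [Pi.single_eq_of_ne (by rintro ⟨⟩; exact ht rfl)]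
      simp [ht]
  · rw [Pi.single_eq_of_ne (by rintro ⟨⟩; exact h.ne rfl)]
    simp [h.not_ge, (h.trans (Nat.lt_succ_self n)).not_ge]

-- Distinct branches are independent modulo finitely supported functions: evaluate at a node of the
-- branch of g so high that it lies outside the support of x and on no other branch of s.
open scoped Nat in
theorem eq_zero_of_sum_branchFun_eq_finsupp (s : Finset (TreeNode A → A)) (k : (TreeNode A → A) → ℤ)
    (x : TreeNode A →₀ ℤ) (h : ∑ g ∈ s, k g • branchFun g 0 = x) {g : TreeNode A → A}
    (hg : g ∈ s) : k g = 0 := by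
  classical
  choose m hm using fun g' => exists_forall_branchNode_ne g' g
  let i := (x.support.sup fun t => t.1 + 1) + s.sup m
  have hx : x ⟨i, branchNode g i⟩ = 0 := by
    by_contra hne
    have : i + 1 ≤ x.support.sup fun t => t.1 + 1 :=
      Finset.le_sup (f := fun t : TreeNode A => t.1 + 1) (Finsupp.mem_support_iff.2 hne)
    omega
  have h' := congrFun h ⟨i, branchNode g i⟩
  rw [hx, Finset.sum_apply, Finset.sum_eq_single_of_mem g hg] at h'
  · simpa [branchFun, Nat.factorial_ne_zero] using h'
  · intro g' hg' hne
    have := hm g' i ((Finset.le_sup hg').trans (Nat.le_add_left _ _)) hne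
    simp [branchFun, this.symm]

end Tree

/-! ### Lifting from powers of ℤ to ℚ -/

theorem exists_seq_eq_add_smul {I : Type*} [AddCommGroup I]
    (hI : ∀ n : ℤ, n ≠ 0 → Function.Surjective fun x : I => n • x) (a : ℕ → I) :
    ∃ b : ℕ → I, ∀ n : ℕ, b n = a n + ((n : ℤ) + 1) • b (n + 1) := by
  choose d hd using fun (n : ℕ) (x : I) => hI ((n : ℤ) + 1) (by omega) x
  -- The initial value is arbitrary; each later one is obtained by division in I.
  let b : ℕ → I := fun n => Nat.rec 0 (fun n x => d n (x - a n)) n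
  refine ⟨b, fun n => ?_⟩
  have : ((n : ℤ) + 1) • b (n + 1) = b n - a n := hd n (b n - a n)
  rw [this, add_sub_cancel]

open scoped Nat in
/-- If maps from all powers of `ℤ` lift along `π : I → J`, then so do the maps from `ℚ`. -/
theorem exists_lift_rat_of_exists_lift_pi {A I J : Type u} [AddCommGroup A] [AddCommGroup I]
    [AddCommGroup J] (ι : A →ₗ[ℤ] I) (π : I →ₗ[ℤ] J) (hex : Function.Exact ι π)
    (hI : ∀ n : ℤ, n ≠ 0 → Function.Surjective fun x : I => n • x)
    (hJ : ∀ n : ℤ, n ≠ 0 → Function.Surjective fun x : J => n • x)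
    (hlift : ∀ (T : Type u) (f : (T → ℤ) →ₗ[ℤ] J), ∃ g : (T → ℤ) →ₗ[ℤ] I, π ∘ₗ g = f)
    (h : ℚ →ₗ[ℤ] J) : ∃ g : ℚ →ₗ[ℤ] I, π ∘ₗ g = h := by
  classical
  let K : Submodule ℤ (TreeNode A → ℤ) := LinearMap.range (Finsupp.lcoeFun (α := TreeNode A))
  have hK : ∀ t, Pi.single t 1 ∈ K := fun t =>
    ⟨Finsupp.single t 1, Finsupp.single_eq_pi_single _ _⟩
  have hw : ∀ (g : TreeNode A → A) (n : ℕ),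
      K.mkQ (branchFun g n) = ((n : ℤ) + 1) • K.mkQ (branchFun g (n + 1)) := by
    intro g n
    rw [branchFun_eq, map_add, map_zsmul, Submodule.mkQ_apply _ (Pi.single _ _),
      (Submodule.Quotient.mk_eq_zero K).2 (hK _), add_zero]
  choose θ₁ hθ₁ using fun g => Rat.exists_linearMap_factorial _ (hw g)
  let θ : ((TreeNode A → A) →₀ ℚ) →ₗ[ℤ] (TreeNode A → ℤ) ⧸ K := Finsupp.lsum ℤ θ₁
  have hθ : Function.Injective θ := by
    refine (injective_iff_map_eq_zero θ).2 fun v hv => ?_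
    -- Clearing denominators turns a relation over ℚ into an integral one among the `branchFun g 0`.
    obtain ⟨N, hN⟩ := IsLocalization.exist_integer_multiples_of_finset (nonZeroDivisors ℤ)
      (v.support.image v)
    choose! k hk using fun g (hg : g ∈ v.support) => hN (v g) (Finset.mem_image_of_mem v hg)
    have hk' : ∀ g ∈ v.support, θ₁ g ((N : ℤ) • v g) = k g • K.mkQ (branchFun g 0) := by
      intro g hg
      have h₁ : (N : ℤ) • v g = k g • (1 / (0 ! : ℕ) : ℚ) := by
        simpa using (hk g hg).symm
      rw [h₁, map_zsmul, hθ₁]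
    have hsum : K.mkQ (∑ g ∈ v.support, k g • branchFun g 0) = 0 := by
      have : (N : ℤ) • θ v = 0 := by rw [hv, smul_zero]
      rw [← this, Finsupp.lsum_apply, Finsupp.sum, Finset.smul_sum, map_sum]
      refine Finset.sum_congr rfl fun g hg => ?_
      rw [← map_zsmul (θ₁ g), hk' g hg, map_zsmul]
    obtain ⟨x, hx⟩ := (Submodule.Quotient.mk_eq_zero K).1 hsum
    ext g
    by_contra hne
    have hg : g ∈ v.support := Finsupp.mem_support_iff.2 hne
    have hkg := eq_zero_of_sum_branchFun_eq_finsupp v.support k x hx.symm hg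
    have := hk g hg
    rw [hkg, map_zero] at this
    exact hne ((smul_eq_zero.1 this.symm).resolve_left (nonZeroDivisors.ne_zero N.2))
  -- `b g` encodes the labels of g along its own branch. As π kills the labels, h can be perturbed
  -- by π ∘ b on the copy of ℚ belonging to g.
  choose b hb using fun g : TreeNode A → A =>
    exists_seq_eq_add_smul hI fun n => ι (g ⟨n, branchNode g n⟩)
  have hη : ∀ (g : TreeNode A → A) (n : ℕ), h (1 / n !) + π (b g n) =
      ((n : ℤ) + 1) • (h (1 / (n + 1)!) + π (b g (n + 1))) := by
    intro g n
    have h₁ : (1 / n ! : ℚ) = ((n : ℤ) + 1) • (1 / (n + 1)! : ℚ) := by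
      rw [Nat.factorial_succ, zsmul_eq_mul]
      have : (n ! : ℚ) ≠ 0 := by exact_mod_cast n.factorial_ne_zero
      push_cast
      field_simp
    rw [hb g n, map_add, hex.apply_apply_eq_zero, zero_add, h₁, map_zsmul, map_zsmul, smul_add]
  choose η₁ hη₁ using fun g => Rat.exists_linearMap_factorial _ (hη g)
  obtain ⟨η, hηθ⟩ := exists_extension_of_divisible hJ θ hθ (Finsupp.lsum ℤ η₁)
  obtain ⟨Λ, hΛ⟩ := hlift (TreeNode A) (η ∘ₗ K.mkQ)
  have hΛ' : ∀ x, π (Λ x) = η (K.mkQ x) := fun x => LinearMap.congr_fun hΛ x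
  -- Unit vectors vanish modulo K, so Λ sends them into A. This defines the labelling ψ.
  have hψ : ∀ t, ∃ a, ι a = Λ (Pi.single t 1) := fun t => (hex _).1 (by
    rw [hΛ', Submodule.mkQ_apply, (Submodule.Quotient.mk_eq_zero K).2 (hK _), map_zero])
  choose ψ hψ using hψ
  -- On the branch of ψ, the error terms of Λ are exactly the labels built into `b ψ`; they cancel
  -- in the difference, which therefore comes from a map on ℚ.
  obtain ⟨g, hg⟩ := Rat.exists_linearMap_factorial
    (fun n => Λ (branchFun ψ n) - b ψ n) fun n => by
      rw [branchFun_eq, hb ψ n, map_add, ← hψ, map_zsmul, smul_sub]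
      abel
  refine ⟨g, Rat.linearMap_ext_factorial fun n => ?_⟩
  have h₁ : η (K.mkQ (branchFun ψ n)) = h (1 / n !) + π (b ψ n) := by
    have := hηθ (Finsupp.single ψ (1 / n !))
    simpa only [θ, Finsupp.lsum_single, hθ₁, hη₁] using this
  rw [LinearMap.comp_apply, hg, map_sub, hΛ', h₁, add_sub_cancel_right]

/-! ### Pure closures and ℵ₁-freeness -/

section PureClosure

variable {R : Type*} [CommRing R] [IsDomain R]
  {M : Type*} [AddCommGroup M] [Module R M]

/-- The pure closure of a subgroup `N`: the elements with a nonzero multiple in `N`. -/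
def pureClosure (N : Submodule R M) : Submodule R M :=
  (Submodule.torsion R (M ⧸ N)).comap N.mkQ

theorem mem_pureClosure {N : Submodule R M} {x : M} :
    x ∈ pureClosure N ↔ ∃ n : R, n ≠ 0 ∧ n • x ∈ N := by
  simp only [pureClosure, Submodule.mem_comap, Submodule.mem_torsion_iff, Submodule.mkQ_apply]
  constructor
  · rintro ⟨⟨n, hn⟩, h⟩
    refine ⟨n, nonZeroDivisors.ne_zero hn, ?_⟩
    rw [← Submodule.Quotient.mk_eq_zero]
    simpa using h
  · rintro ⟨n, hn, h⟩
    refine ⟨⟨n, mem_nonZeroDivisors_of_ne_zero hn⟩, ?_⟩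
    rw [← Submodule.Quotient.mk_eq_zero] at h
    simpa using h

theorem le_pureClosure (N : Submodule R M) : N ≤ pureClosure N := fun x hx =>
  mem_pureClosure.2 ⟨1, one_ne_zero, by simpa using hx⟩

theorem pureClosure_mono {N N' : Submodule R M} (h : N ≤ N') : pureClosure N ≤ pureClosure N' := by
  intro x hx
  obtain ⟨n, hn, hx⟩ := mem_pureClosure.1 hx
  exact mem_pureClosure.2 ⟨n, hn, h hx⟩

theorem isTorsionFree_iff_forall :
    Module.IsTorsionFree R M ↔ ∀ (n : R) (x : M), n ≠ 0 → n • x = 0 → x = 0 := by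
  rw [Module.isTorsionFree_iff_smul_eq_zero]
  refine ⟨fun h n x hn hx => ?_, fun h n x hx => ?_⟩
  · exact (h n x hx).resolve_left hn
  · by_cases hn : n = 0
    · exact .inl hn
    · exact .inr (h n x hn hx)

instance isTorsionFree_quotient_pureClosure (N : Submodule R M) :
    Module.IsTorsionFree R (M ⧸ pureClosure N) := by
  refine isTorsionFree_iff_forall.2 fun n x hn hx => ?_
  obtain ⟨x, rfl⟩ := Submodule.Quotient.mk_surjective _ x
  rw [← Submodule.Quotient.mk_smul, Submodule.Quotient.mk_eq_zero] at hx
  rw [Submodule.Quotient.mk_eq_zero]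
  obtain ⟨m, hm, h⟩ := mem_pureClosure.1 hx
  exact mem_pureClosure.2 ⟨m * n, mul_ne_zero hm hn, by rwa [mul_smul]⟩

theorem pureClosure_bot [Module.IsTorsionFree R M] : pureClosure (⊥ : Submodule R M) = ⊥ := by
  refine (Submodule.eq_bot_iff _).2 fun x hx => ?_
  obtain ⟨n, hn, h⟩ := mem_pureClosure.1 hx
  exact isTorsionFree_iff_forall.1 ‹_› n x hn h

variable [IsPrincipalIdealRing R]

theorem Submodule.FG.of_le_of_pid {P P' : Submodule R M} (hP : P'.FG) (h : P ≤ P') : P.FG := by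
  have : IsNoetherian R P' := isNoetherian_of_fg_of_noetherian _ hP
  have := (IsNoetherian.noetherian (P.comap P'.subtype)).map P'.subtype
  rwa [Submodule.map_comap_subtype, inf_eq_right.2 h] at this

theorem Submodule.FG.free_of_pid [Module.IsTorsionFree R M] {P : Submodule R M} (hP : P.FG) :
    Module.Free R P := by
  have : Module.Finite R P := Module.Finite.of_fg hP
  exact Module.free_of_finite_type_torsion_free'

/-- The image of P' in M ⧸ P is finitely generated and torsion-free, hence free, so P' → M ⧸ P
splits over its image. -/
theorem exists_retraction_of_isTorsionFree_quotient {P P' : Submodule R M} (hP : P'.FG)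
    [Module.IsTorsionFree R (M ⧸ P)] :
    ∃ r : P' →ₗ[R] P, ∀ x : P', ∀ hx : (x : M) ∈ P, r x = ⟨x, hx⟩ := by
  let f : P' →ₗ[R] M ⧸ P := P.mkQ ∘ₗ P'.subtype
  have : Module.Finite R P' := Module.Finite.of_fg hP
  have : Module.Finite R (LinearMap.range f) := Module.Finite.range f
  have : Module.Free R (LinearMap.range f) := Module.free_of_finite_type_torsion_free'
  obtain ⟨g, hg⟩ := Module.projective_lifting_property f.rangeRestrict LinearMap.id
    f.surjective_rangeRestrict
  let p : P' →ₗ[R] P' := LinearMap.id - g ∘ₗ f.rangeRestrict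
  have key : ∀ x : P', (p x : M) ∈ P := by
    intro x
    have : f (p x) = 0 := by
      have := congrArg Subtype.val (LinearMap.congr_fun hg (f.rangeRestrict x))
      simp only [LinearMap.comp_apply, LinearMap.id_apply, LinearMap.codRestrict_apply,
        LinearMap.rangeRestrict] at this
      simp only [p, LinearMap.sub_apply, LinearMap.comp_apply, LinearMap.id_apply, map_sub,
        sub_eq_zero, LinearMap.rangeRestrict]
      exact this.symm
    exact (Submodule.Quotient.mk_eq_zero _).1 this
  refine ⟨(P'.subtype ∘ₗ p).codRestrict P key, fun x hx => Subtype.ext ?_⟩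
  have hfx : f.rangeRestrict x = 0 := Subtype.ext ((Submodule.Quotient.mk_eq_zero _).2 hx)
  change ((x - g (f.rangeRestrict x) : P') : M) = x
  rw [hfx, map_zero, sub_zero]

theorem exists_disjoint_sup_eq_of_isTorsionFree_quotient {P P' : Submodule R M} (hP : P'.FG)
    (hle : P ≤ P') [Module.IsTorsionFree R (M ⧸ P)] :
    ∃ C : Submodule R M, Disjoint P C ∧ P ⊔ C = P' := by
  obtain ⟨r, hr⟩ := exists_retraction_of_isTorsionFree_quotient (P := P) hP
  refine ⟨(LinearMap.ker r).map P'.subtype, ?_, le_antisymm ?_ ?_⟩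
  · rw [Submodule.disjoint_def]
    rintro _ hx ⟨x, hx', rfl⟩
    have := hr x hx
    rw [LinearMap.mem_ker.1 hx'] at this
    exact congrArg Subtype.val this.symm
  · exact sup_le hle (Submodule.map_subtype_le _ _)
  · intro x hx
    rw [Submodule.mem_sup]
    refine ⟨r ⟨x, hx⟩, (r _).2, x - r ⟨x, hx⟩, ⟨⟨x, hx⟩ - ⟨r ⟨x, hx⟩, hle (r _).2⟩, ?_, rfl⟩,
      by abel⟩
    have := hr ⟨r ⟨x, hx⟩, hle (r ⟨x, hx⟩).2⟩ (r ⟨x, hx⟩).2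
    exact LinearMap.mem_ker.2 (by rw [map_sub, this, sub_eq_zero])

/-- The pure closures of finitely generated subgroups are finitely generated. -/
def HasFGPureClosures (R : Type*) [CommRing R] [IsDomain R] (M : Type*) [AddCommGroup M]
    [Module R M] : Prop :=
  ∀ N : Submodule R M, N.FG → (pureClosure N).FG

theorem HasFGPureClosures.of_injective {M' : Type*} [AddCommGroup M'] [Module R M'] (f : M' →ₗ[R] M)
    (hf : Function.Injective f) (h : HasFGPureClosures R M) : HasFGPureClosures R M' := by
  intro N hN
  refine Submodule.fg_of_fg_map_injective f hf
    (Submodule.FG.of_le_of_pid (h (N.map f) (hN.map f)) ?_)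
  rintro _ ⟨x, hx, rfl⟩
  obtain ⟨n, hn, hx⟩ := mem_pureClosure.1 hx
  exact mem_pureClosure.2 ⟨n, hn, n • x, hx, by simp⟩

/-- **Pontryagin's criterion**. -/
theorem HasFGPureClosures.free_of_countable [Module.IsTorsionFree R M] [Countable M]
    (h : HasFGPureClosures R M) : Module.Free R M := by
  obtain ⟨s, hs⟩ := exists_surjective_nat M
  -- A chain of finitely generated pure submodules exhausting M. Each is a direct summand of the
  -- next, and M is the direct sum of the free complements.
  let P : ℕ → Submodule R M := fun n => pureClosure (Submodule.span R (s '' Set.Iio n))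
  have hfg : ∀ n, (P n).FG := fun n => h _ (Submodule.fg_span ((Set.finite_Iio n).image s))
  have hmono : ∀ n, P n ≤ P (n + 1) := fun n => pureClosure_mono
    (Submodule.span_mono (Set.image_mono (Set.Iio_subset_Iio n.le_succ)))
  have hP0 : P 0 = ⊥ := by
    simp only [P]
    simpa using pureClosure_bot
  choose C hC hC' using fun n =>
    exists_disjoint_sup_eq_of_isTorsionFree_quotient (hfg (n + 1)) (hmono n)
  have hCfg : ∀ n, (C n).FG := fun n =>
    Submodule.FG.of_le_of_pid (hfg (n + 1)) (hC' n ▸ le_sup_right)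
  have hle : ∀ n i, i < n → C i ≤ P n := by
    intro n
    induction n with
    | zero => intro i hi; omega
    | succ n ih =>
      intro i hi
      rcases Nat.lt_succ_iff_lt_or_eq.1 hi with hi | rfl
      · exact (ih i hi).trans (hmono n)
      · exact hC' i ▸ le_sup_right
  have hPle : ∀ n, P n ≤ ⨆ i, C i := by
    intro n
    induction n with
    | zero => rw [hP0]; exact bot_le
    | succ n ih => rw [← hC' n]; exact sup_le ih (le_iSup C n)
  have htop : ⨆ i, C i = ⊤ := by
    refine eq_top_iff.2 fun x _ => ?_
    obtain ⟨n, rfl⟩ := hs x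
    exact hPle (n + 1) (le_pureClosure _ (Submodule.subset_span ⟨n, by simp, rfl⟩))
  have hsum : ∀ (n : ℕ) (v : ℕ → M), (∀ i, v i ∈ C i) → ∑ i ∈ Finset.range n, v i = 0 →
      ∀ i < n, v i = 0 := by
    intro n v hv
    induction n with
    | zero => intro _ i hi; omega
    | succ n ih =>
      intro h0 i hi
      rw [Finset.sum_range_succ] at h0
      have hn : v n = 0 := by
        refine (Submodule.disjoint_def.1 (hC n)) _ ?_ (hv n)
        rw [eq_neg_of_add_eq_zero_right h0]
        exact neg_mem (Submodule.sum_mem _ fun i hi => hle n i (Finset.mem_range.1 hi) (hv i))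
      rcases Nat.lt_succ_iff_lt_or_eq.1 hi with hi | rfl
      · exact ih (by simpa [hn] using h0) i hi
      · exact hn
  have hind : iSupIndep C := by
    rw [iSupIndep_iff_finsetSum_eq_zero_imp_eq_zero]
    intro t v hv h0 i hi
    have hv' : ∀ j, (fun j => if j ∈ t then v j else 0) j ∈ C j := by
      intro j
      by_cases hj : j ∈ t
      · simpa [hj] using hv j hj
      · simp [hj]
    obtain ⟨n, hn⟩ := t.exists_nat_subset_range
    have := hsum n _ hv' (by
      rw [← Finset.sum_filter, ← h0]
      congr 1
      ext j
      simpa using fun hj => Finset.mem_range.1 (hn hj)) i (Finset.mem_range.1 (hn hi))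
    simpa [hi] using this
  have hint := DirectSum.isInternal_submodule_of_iSupIndep_of_iSup_eq_top hind htop
  have : ∀ i, Module.Free R (C i) := fun i => (hCfg i).free_of_pid
  exact Module.Free.of_equiv (LinearEquiv.ofBijective (DirectSum.coeLinearMap C) hint)

theorem isAlephOneFree_of_hasFGPureClosures [Countable R] [Module.IsTorsionFree R M] (h : HasFGPureClosures R M) :
    IsAlephOneFree R M := by
  intro s hs
  have : Countable (Submodule.span R s) := by
    have := hs.to_subtype
    rw [Finsupp.span_eq_range_linearCombination]
    exact (Set.countable_range _).to_subtype
  exact (h.of_injective _ (Submodule.injective_subtype _)).free_of_countable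

omit [IsPrincipalIdealRing R] in
theorem IsAlephOneFree.isTorsionFree (h : IsAlephOneFree R M) : Module.IsTorsionFree R M := by
  refine isTorsionFree_iff_forall.2 fun n x hn hx => ?_
  have := h {x} (Set.countable_singleton x)
  have hx' : n • (⟨x, Submodule.mem_span_singleton_self x⟩ : Submodule.span R {x}) = 0 :=
    Subtype.ext hx
  have := isTorsionFree_iff_forall.1 inferInstance n _ hn hx'
  exact congrArg Subtype.val this

-- The pure closure is countable, since x is determined by a multiplier n and by n • x ∈ N; hence it
-- is free. Generators of N involve finitely many basis vectors, and there are no others, because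
-- each basis vector has a nonzero multiple in N.
omit [IsPrincipalIdealRing R] in
theorem IsAlephOneFree.hasFGPureClosures [Countable R] (h : IsAlephOneFree R M) : HasFGPureClosures R M := by
  have htf := h.isTorsionFree
  intro N hN
  have hcount : (pureClosure N : Set M).Countable := by
    have hNc : Countable N := by
      obtain ⟨s, rfl⟩ := hN
      rw [Finsupp.span_eq_range_linearCombination]
      exact (Set.countable_range _).to_subtype
    choose n hn hx using fun x : pureClosure N => mem_pureClosure.1 x.2
    have hinj : Function.Injective fun x : pureClosure N => (n x, (⟨_, hx x⟩ : N)) := by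
      intro x y hxy
      simp only [Prod.mk.injEq, Subtype.mk.injEq] at hxy
      have := isTorsionFree_iff_forall.1 htf (n x) (x - y) (hn x)
        (by rw [smul_sub, hxy.2, hxy.1, sub_self])
      exact Subtype.ext (sub_eq_zero.1 this)
    exact Set.countable_coe_iff.1 hinj.countable
  have hfree := h _ hcount
  rw [Submodule.span_eq] at hfree
  let b := Module.Free.chooseBasis R (pureClosure N)
  classical
  let N' : Submodule R (pureClosure N) := N.comap (pureClosure N).subtype
  have hN' : N'.FG := by
    refine Submodule.fg_of_fg_map_injective _ (Submodule.injective_subtype (pureClosure N)) ?_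
    rwa [Submodule.map_comap_subtype, inf_eq_right.2 (le_pureClosure N)]
  obtain ⟨s, hs⟩ := hN'
  let t : Finset _ := s.biUnion fun x => (b.repr x).support
  suffices hfin : Set.univ ⊆ (t : Set (Module.Free.ChooseBasisIndex R (pureClosure N))) by
    have : Finite (Module.Free.ChooseBasisIndex R (pureClosure N)) :=
      Set.finite_univ_iff.1 (t.finite_toSet.subset hfin)
    have := Module.Finite.of_basis b
    exact Module.Finite.iff_fg.1 this
  intro i _
  by_contra hi
  have hzero : ∀ x ∈ N', b.repr x i = 0 := by
    intro x hx
    rw [← hs] at hx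
    induction hx using Submodule.span_induction with
    | mem x hx =>
      by_contra hne
      exact hi (Finset.mem_coe.2 (Finset.mem_biUnion.2 ⟨x, hx, Finsupp.mem_support_iff.2 hne⟩))
    | zero => simp
    | add x y _ _ hx hy => simp [hx, hy]
    | smul a x _ hx => simp [hx]
  obtain ⟨n, hn, hb⟩ := mem_pureClosure.1 (b i).2
  have := hzero (n • b i) hb
  simp [hn] at this

-- Induction on the generators: each new one costs at most one more coordinate, at which some
-- element vanishing on the old coordinates is nonzero.
omit [IsPrincipalIdealRing R] in
theorem exists_finset_forall_eq_zero_of_fg {T : Type*} {N : Submodule R (T → R)} (hN : N.FG) :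
    ∃ T₀ : Finset T, ∀ x ∈ N, (∀ t ∈ T₀, x t = 0) → x = 0 := by
  classical
  obtain ⟨s, rfl⟩ := hN
  induction s using Finset.induction_on with
  | empty => exact ⟨∅, fun x hx _ => by simpa using hx⟩
  | insert v s _ ih =>
    obtain ⟨T₀, hT₀⟩ := ih
    rw [Finset.coe_insert]
    by_cases h : ∀ x ∈ Submodule.span R (insert v (s : Set (T → R))),
        (∀ t ∈ T₀, x t = 0) → x = 0
    · exact ⟨T₀, h⟩
    push Not at h
    obtain ⟨x, hx, hxT, hx0⟩ := h
    obtain ⟨t, ht⟩ := Function.ne_iff.1 hx0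
    refine ⟨insert t T₀, fun y hy hyT => ?_⟩
    obtain ⟨a, x', hx', rfl⟩ := Submodule.mem_span_insert.1 hx
    obtain ⟨b, y', hy', rfl⟩ := Submodule.mem_span_insert.1 hy
    have ha : a ≠ 0 := by
      rintro rfl
      rw [zero_smul, zero_add] at hx0 hxT
      exact hx0 (hT₀ _ hx' hxT)
    -- This combination equals a • y - b • x with the generator v eliminated, so the induction
    -- hypothesis applies to it.
    have key := hT₀ (a • y' - b • x')
      (sub_mem (Submodule.smul_mem _ _ hy') (Submodule.smul_mem _ _ hx')) fun u hu => by
        have h₁ := hxT u hu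
        have h₂ := hyT u (Finset.mem_insert_of_mem hu)
        simp only [Pi.add_apply, Pi.smul_apply, Pi.sub_apply, smul_eq_mul] at h₁ h₂ ⊢
        linear_combination a * h₂ - b * h₁
    have hb : b = 0 := by
      have h₁ := congrFun key t
      have h₂ := hyT t (Finset.mem_insert_self _ _)
      simp only [Pi.add_apply, Pi.smul_apply, Pi.sub_apply, smul_eq_mul, Pi.zero_apply]
        at h₁ h₂ ht
      refine (mul_eq_zero.1 (?_ : b * (a * v t + x' t) = 0)).resolve_right ht
      linear_combination a * h₂ - h₁
    subst hb
    rw [zero_smul, zero_add] at hyT ⊢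
    exact hT₀ _ hy' fun u hu => hyT u (Finset.mem_insert_of_mem hu)

/-- Restriction to finitely many coordinates is injective on N, hence on its pure closure, which
thus embeds in a free module of finite rank. -/
theorem hasFGPureClosures_pi (T : Type*) : HasFGPureClosures R (T → R) := by
  intro N hN
  obtain ⟨T₀, hT₀⟩ := exists_finset_forall_eq_zero_of_fg hN
  let f : pureClosure N →ₗ[R] (T₀ → R) :=
    LinearMap.funLeft R R (Subtype.val : T₀ → T) ∘ₗ (pureClosure N).subtype
  have hf : Function.Injective f := by
    refine (injective_iff_map_eq_zero f).2 fun x hx => ?_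
    obtain ⟨n, hn, h⟩ := mem_pureClosure.1 x.2
    have := hT₀ _ h fun t ht => by
      have : (x : T → R) t = 0 := congrFun hx ⟨t, ht⟩
      simp [this]
    exact Subtype.ext (isTorsionFree_iff_forall.1 inferInstance n _ hn this)
  exact Module.Finite.iff_fg.1 (Module.Finite.of_injective f hf)

end PureClosure

/-! ### Mittag-Leffler modules and pure closures -/

section MittagLeffler

variable {R : Type*} [CommRing R] [IsDomain R] [IsPrincipalIdealRing R]
  {M : Type u} [AddCommGroup M] [Module R M]

theorem Module.Flat.exists_of_sum_tmul_eq_zero {R M Y ι : Type*} [CommRing R] [AddCommGroup M]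
    [Module R M] [AddCommGroup Y] [Module R Y] [Module.Flat R M] [Fintype ι] {m : ι → M} {y : ι → Y}
    (h : ∑ i, m i ⊗ₜ[R] y i = 0) :
    ∃ (k : ℕ) (a : ι → Fin k → R) (m' : Fin k → M),
      (∀ i, m i = ∑ j, a i j • m' j) ∧ ∀ j, ∑ i, a i j • y i = 0 := by
  have h' : ∑ i, y i ⊗ₜ[R] m i = 0 := by
    simpa using congrArg (TensorProduct.comm R M Y) h
  exact TensorProduct.vanishesTrivially_of_sum_tmul_eq_zero_of_rTensor_injective R
    (Module.Flat.rTensor_preserves_injective_linearMap _ (Submodule.injective_subtype _)) h'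

/-- The equational criterion writes the b i in terms of finitely many m j. Retracting the m j to the
pure closure and taking i-th coordinates expresses y i through the vanishing sums ∑ l, a l j • y l.
-/
theorem HasFGPureClosures.eq_zero_of_sum_tmul_eq_zero [Module.IsTorsionFree R M] [Module.Flat R M]
    (h : HasFGPureClosures R M) {N : Submodule R M} {ι Y : Type*} [Fintype ι]
    [AddCommGroup Y] [Module R Y] (b : Module.Basis ι R (pureClosure N)) (hN : N.FG) {y : ι → Y}
    (hy : ∑ i, (b i : M) ⊗ₜ[R] y i = 0) (i : ι) : y i = 0 := by
  classical
  obtain ⟨k, a, m, hm, ha⟩ := Module.Flat.exists_of_sum_tmul_eq_zero hy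
  let N' := pureClosure N ⊔ Submodule.span R (Set.range m)
  have hN' : N'.FG := (h N hN).sup (Submodule.fg_span (Set.finite_range m))
  obtain ⟨r, hr⟩ := exists_retraction_of_isTorsionFree_quotient (P := pureClosure N) hN'
  have hmem : ∀ j, m j ∈ N' := fun j => le_sup_right (a := pureClosure N)
    (Submodule.subset_span ⟨j, rfl⟩)
  have hb : ∀ l, ∑ j, a l j • r ⟨m j, hmem j⟩ = b l := by
    intro l
    have := hr (∑ j, a l j • ⟨m j, hmem j⟩) (by simp [← hm])
    rw [map_sum] at this
    simp_rw [map_smul] at this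
    rw [this]
    ext
    simp [← hm]
  have hδ : ∀ l, ∑ j, a l j * b.repr (r ⟨m j, hmem j⟩) i = if l = i then 1 else 0 := by
    intro l
    have := congrArg (fun x => b.repr x i) (hb l)
    simpa [Finsupp.single_apply, Finsupp.finsetSum_apply] using this
  calc y i = ∑ l, (if l = i then (1 : R) else 0) • y l := by simp
    _ = ∑ j, b.repr (r ⟨m j, hmem j⟩) i • ∑ l, a l j • y l := by
      simp_rw [← hδ, Finset.sum_smul, Finset.smul_sum, smul_smul]
      rw [Finset.sum_comm]
      simp_rw [mul_comm]
    _ = 0 := by simp [ha]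

theorem exists_finset_forall_basis_exists_sum_tmul {R M Y : Type*} [CommRing R] [AddCommGroup M]
    [Module R M] [AddCommGroup Y] [Module R Y] (z : M ⊗[R] Y) :
    ∃ s : Finset M, ∀ P : Submodule R M, (s : Set M) ⊆ P → ∀ (ι : Type _) [Fintype ι]
      (b : Module.Basis ι R P), ∃ y : ι → Y, z = ∑ i, (b i : M) ⊗ₜ y i := by
  classical
  obtain ⟨s, rfl⟩ := TensorProduct.exists_finset z
  refine ⟨s.image Prod.fst, fun P hP ι _ b => ?_⟩
  have hmem : ∀ p ∈ s, p.1 ∈ P := fun p hp => hP (by simpa using ⟨p.2, hp⟩)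
  refine ⟨fun i => ∑ p ∈ s.attach, b.repr ⟨p.1.1, hmem p.1 p.2⟩ i • p.1.2, ?_⟩
  simp_rw [TensorProduct.tmul_sum]
  rw [Finset.sum_comm, ← Finset.sum_attach s]
  refine Finset.sum_congr rfl fun p _ => ?_
  simp_rw [← TensorProduct.smul_tmul, ← TensorProduct.sum_tmul]
  congr 1
  have := congrArg Subtype.val (b.sum_repr ⟨p.1.1, hmem p.1 p.2⟩).symm
  rwa [Submodule.coe_sum] at this

/-- Written in a basis of a pure closure, a tensor vanishes only if its coefficients do, and in a
product this can be checked factor by factor. -/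
theorem HasFGPureClosures.isMittagLeffler [Module.IsTorsionFree R M] [Module.Flat R M]
    (h : HasFGPureClosures R M) : IsMittagLeffler R M := by
  intro I Y _ _
  refine (injective_iff_map_eq_zero _).2 fun z hz => ?_
  obtain ⟨s, hs⟩ := exists_finset_forall_basis_exists_sum_tmul z
  have hN : (Submodule.span R (s : Set M)).FG := ⟨s, rfl⟩
  have := (h _ hN).free_of_pid
  have : Module.Finite R (pureClosure (Submodule.span R (s : Set M))) := Module.Finite.of_fg (h _ hN)
  let b := Module.Free.chooseBasis R (pureClosure (Submodule.span R (s : Set M)))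
  obtain ⟨y, rfl⟩ := hs _ (Submodule.subset_span.trans (le_pureClosure _)) _ b
  have hy : ∀ l, y l = 0 := by
    intro l
    ext i
    refine h.eq_zero_of_sum_tmul_eq_zero b hN (y := fun l => y l i) ?_ l
    have := congrFun hz i
    simpa [Finset.sum_apply] using this
  simp [hy]

/-- Test with the family ℤ/n_x, for x in the pure closure, where n_x x = ∑ c_xj f_j. The tensor ∑
f_j ⊗ (c_xj)_x vanishes in every factor, hence vanishes. The equational criterion gives f_j = ∑ a_ji
m_i with n_x ∣ ∑_j c_xj a_ji; cancelling n_x puts every x in the span of the m_i. -/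
theorem IsMittagLeffler.hasFGPureClosures {M : Type u} [AddCommGroup M] [Module.Flat ℤ M] (h : IsMittagLeffler ℤ M) :
    HasFGPureClosures ℤ M := by
  intro N hN
  obtain ⟨k, f, rfl⟩ := Submodule.fg_iff_exists_fin_generating_family.1 hN
  choose n hn hx using fun x : pureClosure (Submodule.span ℤ (Set.range f)) =>
    mem_pureClosure.1 x.2
  choose c hc using fun x => (Submodule.mem_span_range_iff_exists_fun ℤ).1 (hx x)
  let y : Fin k → (x : pureClosure (Submodule.span ℤ (Set.range f))) →
      ULift.{u} (ZMod (n x).natAbs) := fun j x => ULift.up (c x j : ZMod _)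
  have hzero : ∑ j, f j ⊗ₜ[ℤ] y j = 0 := by
    apply h
    rw [map_zero, map_sum]
    ext x
    simp only [TensorProduct.piRightHom_tmul, Finset.sum_apply, Pi.zero_apply]
    let o : ULift.{u} (ZMod (n x).natAbs) := ULift.up 1
    have hy : ∀ j, y j x = c x j • o := fun j => ULift.ext _ _ (by simp [y, o])
    simp_rw [hy, ← TensorProduct.smul_tmul, ← TensorProduct.sum_tmul, hc]
    rw [TensorProduct.smul_tmul]
    have : n x • o = 0 := ULift.ext _ _ (by
      simpa [o] using (ZMod.intCast_zmod_eq_zero_iff_dvd _ _).2 (Int.natAbs_dvd.2 dvd_rfl))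
    rw [this, TensorProduct.tmul_zero]
  obtain ⟨l, a, m, hm, ha⟩ := Module.Flat.exists_of_sum_tmul_eq_zero hzero
  refine Submodule.FG.of_le_of_pid (Submodule.fg_span (Set.finite_range m)) fun x hx' => ?_
  set x' : pureClosure (Submodule.span ℤ (Set.range f)) := ⟨x, hx'⟩
  have hdvd : ∀ i, n x' ∣ ∑ j, c x' j * a j i := by
    intro i
    have := congrArg (AddEquiv.ulift (α := ZMod _)) (congrFun (ha i) x')
    rw [Finset.sum_apply, map_sum] at this
    rw [← Int.natAbs_dvd, ← ZMod.intCast_zmod_eq_zero_iff_dvd]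
    have hdown : ∀ u : ULift.{u} (ZMod (n x').natAbs), AddEquiv.ulift u = u.down := fun _ => rfl
    simpa [y, mul_comm, hdown] using this
  choose d hd using hdvd
  have : n x' • (x - ∑ i, d i • m i) = 0 := by
    rw [smul_sub, ← hc x']
    simp_rw [hm, Finset.smul_sum, smul_smul, ← hd, Finset.sum_smul]
    rw [Finset.sum_comm, sub_self]
  rw [sub_eq_zero.1 (isTorsionFree_iff_forall.1 inferInstance _ _ (hn x') this)]
  exact Submodule.sum_mem _ fun i _ => Submodule.smul_mem _ _ (Submodule.subset_span ⟨i, rfl⟩)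

end MittagLeffler

/-! ### Flat, bounded and torsion test groups -/

section Lift

variable {I J : Type*} [AddCommGroup I] [AddCommGroup J]

/-- Embed X in the rational vector space ℚ ⊗ X, extend f there by divisibility of J, and lift on
each copy of ℚ. -/
theorem exists_lift_of_isTorsionFree {X : Type*} [AddCommGroup X] [Module.Flat ℤ X] (π : I →ₗ[ℤ] J)
    (hJ : ∀ n : ℤ, n ≠ 0 → Function.Surjective fun x : J => n • x)
    (hlift : ∀ h : ℚ →ₗ[ℤ] J, ∃ g : ℚ →ₗ[ℤ] I, π ∘ₗ g = h) (f : X →ₗ[ℤ] J) :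
    ∃ g : X →ₗ[ℤ] I, π ∘ₗ g = f := by
  let b := Module.Basis.ofVectorSpace ℚ (ℚ ⊗[ℤ] X)
  let i : X →ₗ[ℤ] (Module.Basis.ofVectorSpaceIndex ℚ (ℚ ⊗[ℤ] X) →₀ ℚ) :=
    (b.repr.toLinearMap.restrictScalars ℤ) ∘ₗ TensorProduct.mk ℤ ℚ X 1
  have hmk : Function.Injective (TensorProduct.mk ℤ ℚ X 1) := by
    have h := Module.Flat.rTensor_preserves_injective_linearMap (M := X)
      (Algebra.linearMap ℤ ℚ) Int.cast_injective
    have h' := h.comp (TensorProduct.lid ℤ X).symm.injective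
    convert h' using 1
    ext x
    simp
  have hi : Function.Injective i :=
    b.repr.injective.comp hmk
  obtain ⟨F, hF⟩ := exists_extension_of_divisible hJ i hi f
  choose g hg using fun k => hlift (F ∘ₗ Finsupp.lsingle k)
  refine ⟨Finsupp.lsum ℤ g ∘ₗ i, ?_⟩
  have : π ∘ₗ Finsupp.lsum ℤ g = F := by
    ext k x
    simpa using LinearMap.congr_fun (hg k) x
  rw [← LinearMap.comp_assoc, this]
  exact LinearMap.ext hF

/-- Multiplication by n on I kills A, so it factors through a map μ : J → I with π ∘ μ = n; dividing
by n in ℚ corrects the factor. -/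
theorem exists_lift_rat_of_bounded {A : Type*} [AddCommGroup A] (ι : A →ₗ[ℤ] I) (π : I →ₗ[ℤ] J)
    (hπ : Function.Surjective π) (hex : Function.Exact ι π) {n : ℤ} (hn : n ≠ 0)
    (hA : ∀ a : A, n • a = 0) (h : ℚ →ₗ[ℤ] J) : ∃ g : ℚ →ₗ[ℤ] I, π ∘ₗ g = h := by
  have hker : LinearMap.ker π ≤ LinearMap.ker (n • LinearMap.id : I →ₗ[ℤ] I) := by
    intro x hx
    obtain ⟨a, rfl⟩ := (hex x).1 hx
    simp [← map_zsmul, hA]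
  let μ : J →ₗ[ℤ] I := (LinearMap.ker π).liftQ _ hker ∘ₗ
    (π.quotKerEquivOfSurjective hπ).symm.toLinearMap
  have hμ : ∀ x, π (μ x) = n • x := by
    intro x
    obtain ⟨x, rfl⟩ := hπ x
    have : μ (π x) = n • x := by
      simp only [μ, LinearMap.comp_apply, LinearEquiv.coe_coe]
      rw [(LinearEquiv.symm_apply_eq _).2 (π.quotKerEquivOfSurjective_apply_mk hπ x).symm]
      simp
    rw [this, map_zsmul]
  refine ⟨μ ∘ₗ h ∘ₗ (LinearMap.mulLeft ℤ (n : ℚ)⁻¹), LinearMap.ext fun q => ?_⟩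
  simp only [LinearMap.comp_apply, LinearMap.mulLeft_apply, hμ]
  rw [← map_zsmul, zsmul_eq_mul, mul_inv_cancel_left₀ (by exact_mod_cast hn)]

/-- Choose i with n • i = ι 1, where n is the order of z, and extend z ↦ π i to Z. If g lifts the
extension, then g z - i lies in the image of ι, so n kills it; but n • (g z - i) = -ι 1. -/
theorem eq_zero_of_exists_lift {Z : Type*} [AddCommGroup Z] {z : Z} (ι : ZMod (addOrderOf z) →ₗ[ℤ] I)
    (π : I →ₗ[ℤ] J) (hι : Function.Injective ι) (hex : Function.Exact ι π)
    (hI : ∀ n : ℤ, n ≠ 0 → Function.Surjective fun x : I => n • x)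
    (hJ : ∀ n : ℤ, n ≠ 0 → Function.Surjective fun x : J => n • x)
    (hlift : ∀ f : Z →ₗ[ℤ] J, ∃ g : Z →ₗ[ℤ] I, π ∘ₗ g = f) (hz : addOrderOf z ≠ 0) : z = 0 := by
  obtain ⟨i, hi⟩ := hI (addOrderOf z) (by exact_mod_cast hz) (ι 1)
  dsimp only at hi
  let e : ZMod (addOrderOf z) →+ Z := ZMod.lift _ ⟨zmultiplesHom Z z, by
    simp [addOrderOf_nsmul_eq_zero]⟩
  let f : ZMod (addOrderOf z) →+ J := ZMod.lift _ ⟨zmultiplesHom J (π i), by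
    rw [zmultiplesHom_apply, ← map_zsmul, hi, hex.apply_apply_eq_zero]⟩
  have he : Function.Injective e := by
    refine (ZMod.lift_injective _).2 fun m hm => ?_
    rw [ZMod.intCast_zmod_eq_zero_iff_dvd]
    exact addOrderOf_dvd_iff_zsmul_eq_zero.2 hm
  obtain ⟨F, hF⟩ := exists_extension_of_divisible hJ e.toIntLinearMap he f.toIntLinearMap
  obtain ⟨g, hg⟩ := hlift F
  have he1 : e 1 = z := by
    have := ZMod.lift_coe (addOrderOf z) ⟨zmultiplesHom Z z, by
      simp [addOrderOf_nsmul_eq_zero]⟩ 1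
    simpa [e] using this
  have hf1 : f 1 = π i := by
    have := ZMod.lift_coe (addOrderOf z) ⟨zmultiplesHom J (π i), by
      rw [zmultiplesHom_apply, ← map_zsmul, hi, hex.apply_apply_eq_zero]⟩ 1
    simpa [f] using this
  have hgz : π (g z - i) = 0 := by
    have h₁ := hF 1
    have h₂ := LinearMap.congr_fun hg z
    simp only [AddMonoidHom.coe_toIntLinearMap, he1, hf1] at h₁
    rw [LinearMap.comp_apply, h₁] at h₂
    rw [map_sub, h₂, sub_self]
  obtain ⟨a, ha⟩ := (hex _).1 hgz
  have h1 : ι 1 = 0 := by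
    have h₁ : ((addOrderOf z : ℕ) : ℤ) • (g z - i) = 0 := by
      rw [← ha, ← map_zsmul]
      simp
    rw [smul_sub, ← map_zsmul, natCast_zsmul, addOrderOf_nsmul_eq_zero, map_zero, hi,
      zero_sub, neg_eq_zero] at h₁
    exact h₁
  have h10 : (1 : ZMod (addOrderOf z)) = 0 := hι (by rw [h1, map_zero])
  rw [← he1, h10, map_zero]

end Lift

/-! ### The classes and their orthogonals -/

theorem flat_int_iff_isTorsionFree {M : Type*} [AddCommGroup M] :
    Module.Flat ℤ M ↔ Module.IsTorsionFree ℤ M := by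
  rw [IsDedekindDomain.flat_iff_torsion_eq_bot, Submodule.isTorsionFree_iff_torsion_eq_bot]

theorem flatMittagLefflerGroups_iff {M : Type u} [AddCommGroup M] :
    flatMittagLefflerGroups (ModuleCat.of ℤ M) ↔
      Module.IsTorsionFree ℤ M ∧ HasFGPureClosures ℤ M := by
  constructor
  · rintro ⟨h₁, h₂⟩
    have : Module.Flat ℤ M := h₁
    exact ⟨flat_int_iff_isTorsionFree.1 h₁, IsMittagLeffler.hasFGPureClosures h₂⟩
  · rintro ⟨h₁, h₂⟩
    have := flat_int_iff_isTorsionFree.2 h₁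
    exact ⟨this, h₂.isMittagLeffler⟩

theorem alephOneFreeGroups_iff {M : Type u} [AddCommGroup M] :
    alephOneFreeGroups (ModuleCat.of ℤ M) ↔
      Module.IsTorsionFree ℤ M ∧ HasFGPureClosures ℤ M := by
  constructor
  · intro h
    exact ⟨IsAlephOneFree.isTorsionFree h, IsAlephOneFree.hasFGPureClosures h⟩
  · rintro ⟨_, h⟩
    exact isAlephOneFree_of_hasFGPureClosures h

theorem cotorsionGroups_iff_of_lift {A J I : Type u} [AddCommGroup A] [AddCommGroup I]
    [AddCommGroup J] {π : I →ₗ[ℤ] J}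
    (hext : ∀ (X : Type u) [AddCommGroup X],
      Subsingleton (Abelian.Ext (ModuleCat.of ℤ X) (ModuleCat.of ℤ A) 1) ↔
        ∀ f : X →ₗ[ℤ] J, ∃ g : X →ₗ[ℤ] I, π ∘ₗ g = f) :
    cotorsionGroups (ModuleCat.of ℤ A) ↔
      ∀ f : ℚ →ₗ[ℤ] J, ∃ g : ℚ →ₗ[ℤ] I, π ∘ₗ g = f := by
  refine (hext (ULift.{u} ℚ)).trans ⟨fun h f => ?_, fun h f => ?_⟩
  · obtain ⟨g, hg⟩ := h (f ∘ₗ ULift.moduleEquiv.toLinearMap)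
    refine ⟨g ∘ₗ ULift.moduleEquiv.symm.toLinearMap, ?_⟩
    rw [← LinearMap.comp_assoc, hg]
    rfl
  · obtain ⟨g, hg⟩ := h (f ∘ₗ ULift.moduleEquiv.symm.toLinearMap)
    refine ⟨g ∘ₗ ULift.moduleEquiv.toLinearMap, ?_⟩
    rw [← LinearMap.comp_assoc, hg]
    rfl

theorem flatGroups_eq_torsionFreeGroups : flatGroups.{u} = torsionFreeGroups.{u} := by
  funext M
  obtain ⟨M, _, rfl⟩ := M.exists_eq_of_int
  exact propext flat_int_iff_isTorsionFree

theorem flatMittagLefflerGroups_eq : flatMittagLefflerGroups.{u} = alephOneFreeGroups.{u} := by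
  funext M
  obtain ⟨M, _, rfl⟩ := M.exists_eq_of_int
  exact propext (flatMittagLefflerGroups_iff.trans alephOneFreeGroups_iff.symm)

theorem subsingleton_ext_of_flat_of_cotorsion {F A : ModuleCat.{u} ℤ} (hF : flatGroups F)
    (hA : cotorsionGroups A) : Subsingleton (Abelian.Ext F A 1) := by
  obtain ⟨F, _, rfl⟩ := F.exists_eq_of_int
  obtain ⟨A, _, rfl⟩ := A.exists_eq_of_int
  obtain ⟨I, J, _, _, ι, π, hι, hπ, hex, hI, hJ, hext⟩ := exists_divisible_resolution_int A
  have : Module.Flat ℤ F := hF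
  exact (hext F).2 (exists_lift_of_isTorsionFree π hJ ((cotorsionGroups_iff_of_lift hext).1 hA))

theorem extRightPerp_flatMittagLefflerGroups :
    extRightPerp flatMittagLefflerGroups.{u} = cotorsionGroups.{u} := by
  funext A
  refine propext ⟨fun h => ?_, fun h D hD => subsingleton_ext_of_flat_of_cotorsion hD.1 h⟩
  obtain ⟨A, _, rfl⟩ := A.exists_eq_of_int
  obtain ⟨I, J, _, _, ι, π, hι, hπ, hex, hI, hJ, hext⟩ := exists_divisible_resolution_int A
  refine (cotorsionGroups_iff_of_lift hext).2
    (exists_lift_rat_of_exists_lift_pi ι π hex hI hJ fun T => ?_)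
  exact (hext (T → ℤ)).1 (h _ (flatMittagLefflerGroups_iff.2
    ⟨inferInstance, hasFGPureClosures_pi T⟩))

theorem extLeftPerp_cotorsionGroups : extLeftPerp cotorsionGroups.{u} = flatGroups.{u} := by
  funext Z
  refine propext ⟨fun h => ?_, fun h A hA => subsingleton_ext_of_flat_of_cotorsion h hA⟩
  obtain ⟨Z, _, rfl⟩ := Z.exists_eq_of_int
  refine flat_int_iff_isTorsionFree.2 (isTorsionFree_iff_forall.2 fun n z hn hnz => ?_)
  have hz : addOrderOf z ≠ 0 := by
    rw [addOrderOf_ne_zero_iff, isOfFinAddOrder_iff_zsmul_eq_zero]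
    exact ⟨n, hn, hnz⟩
  -- The test group is cyclic of the order of z: bounded, hence cotorsion.
  obtain ⟨I, J, _, _, ι, π, hι, hπ, hex, hI, hJ, hext⟩ :=
    exists_divisible_resolution_int (ULift.{u} (ZMod (addOrderOf z)))
  have hcot := (cotorsionGroups_iff_of_lift hext).2
    (exists_lift_rat_of_bounded ι π hπ hex (n := addOrderOf z) (by exact_mod_cast hz)
      fun a => ULift.ext _ _ (by simp))
  refine eq_zero_of_exists_lift (ι ∘ₗ ULift.moduleEquiv.symm.toLinearMap) π
    (hι.comp ULift.moduleEquiv.symm.injective) ?_ hI hJ ((hext Z).1 (h _ hcot)) hz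
  intro x
  rw [hex x]
  exact (ULift.moduleEquiv (R := ℤ)).symm.surjective.exists

/-- A basis vector of a free group is not divisible by 2. -/
theorem not_alephOneFreeGroups_rat : ¬ alephOneFreeGroups (ModuleCat.of ℤ (ULift.{u} ℚ)) := by
  intro h
  have hfree := h Set.univ Set.countable_univ
  have hmem : ∀ x : ULift.{u} ℚ, x ∈ Submodule.span ℤ (Set.univ : Set (ULift.{u} ℚ)) :=
    fun x => Submodule.subset_span (Set.mem_univ x)
  have : Nontrivial (Submodule.span ℤ (Set.univ : Set (ULift.{u} ℚ))) :=
    ⟨0, ⟨1, hmem 1⟩, fun h => one_ne_zero (congrArg Subtype.val h).symm⟩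
  let b := Module.Free.chooseBasis ℤ (Submodule.span ℤ (Set.univ : Set (ULift.{u} ℚ)))
  obtain ⟨i⟩ := b.index_nonempty
  have hy : b i = (2 : ℤ) • ⟨ULift.up ((b i).1.down / 2), hmem _⟩ :=
    Subtype.ext (ULift.ext _ _ (by simp [mul_div_cancel₀]))
  have := congrArg (fun x => b.repr x i) hy
  simp only [map_zsmul, Module.Basis.repr_self, Finsupp.single_eq_same, Finsupp.smul_apply,
    smul_eq_mul] at this
  omega

theorem mainTheorem9 :
    flatMittagLefflerGroups.{u} = alephOneFreeGroups.{u} ∧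
    (∀ C : ObjectProperty (ModuleCat.{u} ℤ), flatMittagLefflerGroups.{u} ≠ extLeftPerp C) ∧
    extRightPerp flatMittagLefflerGroups.{u} = cotorsionGroups.{u} ∧
    extLeftPerp (extRightPerp flatMittagLefflerGroups.{u}) = flatGroups.{u} ∧
    flatGroups.{u} = torsionFreeGroups.{u} := by
  refine ⟨flatMittagLefflerGroups_eq, fun C hC => ?_, extRightPerp_flatMittagLefflerGroups, ?_,
    flatGroups_eq_torsionFreeGroups⟩
  · refine not_alephOneFreeGroups_rat ?_
    rw [← flatMittagLefflerGroups_eq, hC]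
    intro A hA
    refine subsingleton_ext_of_flat_of_cotorsion
      (flat_int_iff_isTorsionFree.2 (inferInstanceAs (Module.IsTorsionFree ℤ (ULift.{u} ℚ)))) ?_
    -- Each A in C lies in (^⊥C)^⊥ = 𝒟^⊥, so it is cotorsion.
    rw [← extRightPerp_flatMittagLefflerGroups]
    intro D hD
    rw [hC] at hD
    exact hD A hA
  · rw [extRightPerp_flatMittagLefflerGroups, extLeftPerp_cotorsionGroups]
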